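/- Let $n \ge 2$, let $F_n$ be the free group on $x_1, \dots, x_n$, and let $\varphi$ be a virtually inner automorphism of $F_n$, meaning that $\varphi^m$ is an inner automorphism for some integer $m \ge 1$. Let $F_n(t) = F_n \rtimes \langle t \rangle$ be a split extension of $F_n$ by a cyclic group $\langle t \rangle$ of finite or infinite order in which $t^{-1} f t = \varphi(f)$ for all $f \in F_n$. Then the conjugacy problem is solvable in $F_n(t)$: there is an algorithm that decides, for any two words in the letters $x_1^{\pm 1}, \dots, x_n^{\pm 1}, t^{\pm 1}$, whether the elements of $F_n(t)$ that they represent are conjugate in $F_n(t)$. Moreover, there is a computable conjugacy normal form: an algorithm that assigns to every such word $w$ a word $\overline{w}$ in the same letters, representing an element conjugate to the one represented by $w$, such that two words $u$ and $v$ represent conjugate elements if and only if $\overline{u}$ and $\overline{v}$ are the same word. -/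

import Mathlib

/-- An automorphism `φ` of a group is virtually inner if `φ ^ m` is inner for some `m ≥ 1`. -/
def IsVirtuallyInner {F : Type*} [Group F] (φ : MulAut F) : Prop :=
  ∃ m : ℕ, 0 < m ∧ φ ^ m ∈ (MulAut.conj : F →* MulAut F).range

/-- Words in the letters `s i` and `(s i)⁻¹`: the pair `(i, true)` is the letter `s i`, and
`(i, false)` is its formal inverse. Words need not be reduced. -/
abbrev GroupWord (ι : Type*) : Type _ := List (ι × Bool)

/-- The element of `G` that a word in the family `s` represents. -/
def GroupWord.val {G : Type*} [Group G] {ι : Type*} (s : ι → G) (w : GroupWord ι) : G :=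
  (w.map fun a => cond a.2 (s a.1) (s a.1)⁻¹).prod

/-- The conjugacy problem of `G` with respect to the generating family `s` is solvable: some
algorithm decides, for any two words, whether the elements they represent are conjugate in `G`. -/
def ConjugacyProblemSolvable {G : Type*} [Group G] {ι : Type*} [Primcodable ι] (s : ι → G) :
    Prop :=
  ComputablePred fun p : GroupWord ι × GroupWord ι => IsConj (p.1.val s) (p.2.val s)

/-- `nf` is a computable conjugacy normal form: an algorithm that sends each word to a word
representing a conjugate element, such that two words represent conjugate elements if and only if
they are sent to the same word. -/
def IsComputableConjugacyNormalForm {G : Type*} [Group G] {ι : Type*} [Primcodable ι]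
    (s : ι → G) (nf : GroupWord ι → GroupWord ι) : Prop :=
  Computable nf ∧
  (∀ w, IsConj (w.val s) ((nf w).val s)) ∧
  ∀ u v, IsConj (u.val s) (v.val s) ↔ nf u = nf v

/-- The standard generators `x₁, …, xₙ, t` of `Fₙ ⋊ ⟨t⟩`: `some i` stands for the free
generator `xᵢ`, and `none` stands for `t`. -/
def splitExtensionGen {n : ℕ} {C : Type*} [Group C] (θ : C →* MulAut (FreeGroup (Fin n)))
    (t : C) : Option (Fin n) → FreeGroup (Fin n) ⋊[θ] C
  | some i => SemidirectProduct.inl (FreeGroup.of i)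
  | none => SemidirectProduct.inr t

/-
If `θ t ^ m` is conjugation by an element `h` fixed by `θ t`, then `h⁻¹ t ^ m` is central in
`F ⋊ ⟨t⟩`. Dividing by powers of it leaves finitely many cosets of `F` to consider, both for the
elements to be compared and for the conjugators, so it is enough to bound the conjugators lying in
`F` for elements `x` whose exponent of `t` is fixed.

Some power `x ^ p` of such an `x` acts on `F` by conjugation by an element `g₀` of `F` that commutes
with `x`. If `g₀ ≠ 1`, then a conjugator from `x` to `y` also conjugates `g₀` to the corresponding
element for `y`, so multiplying it by a power of the latter makes it short. If `g₀ = 1`, then the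
action of `x` on `F`, seen as a quasi-isometry of the Cayley tree, has orbits that close up after
`p` steps with a bounded error. Conjugating by a quasi-centre of the orbit of `1` brings `x` into a
finite set that does not depend on `x`, and finitely many conjugators suffice within that set.

A bound on the length of a shortest conjugator turns the decidable word problem into a decision
procedure for conjugacy, and the element with the smallest code in each class is a normal form.
-/

/-- The elements `h, φ h, …, φ ^ (m - 1) h` commute with each other and all induce `φ ^ m`, and `φ`
permutes them cyclically, so `φ` fixes their product. -/
theorem IsVirtuallyInner.exists_pow_eq_conj {F : Type*} [Group F] {φ : MulAut F}
    (hφ : IsVirtuallyInner φ) : ∃ m : ℕ, 0 < m ∧ ∃ h : F, φ ^ m = MulAut.conj h ∧ φ h = h := by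
  obtain ⟨m, hm, h, hh⟩ := hφ
  have hfix : (φ ^ m) h = h := by simp [← hh]
  have hcomm (i : ℕ) : Commute h ((φ ^ i) h) := by
    have : MulAut.conj h ((φ ^ i) h) = (φ ^ i) h := by
      rw [hh, ← MulAut.mul_apply, pow_mul_comm, MulAut.mul_apply, hfix]
    exact mul_inv_eq_iff_eq_mul.1 this
  have hconj (i : ℕ) : MulAut.conj ((φ ^ i) h) = φ ^ m := by
    ext x
    calc (φ ^ i) h * x * ((φ ^ i) h)⁻¹ = (φ ^ i) (MulAut.conj h ((φ ^ i)⁻¹ x)) := by simp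
      _ = (φ ^ i * φ ^ m * (φ ^ i)⁻¹) x := by rw [hh]; rfl
      _ = (φ ^ m) x := by rw [pow_mul_comm, mul_inv_cancel_right]
  let k : F := ((List.range m).map fun i => (φ ^ i) h).prod
  refine ⟨m * m, Nat.mul_pos hm hm, k, ?_, ?_⟩
  · simp only [k, map_list_prod, List.map_map, Function.comp_def, hconj]
    simp [pow_mul]
  · have hk : φ k = ((List.range m).map fun i => (φ ^ (i + 1)) h).prod := by
      simp [k, map_list_prod, List.map_map, Function.comp_def, pow_succ']
    have hhk : Commute h k := Commute.list_prod_right _ _ <|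
      List.forall_mem_map.2 fun i _ => hcomm i
    refine mul_left_cancel (a := h) ?_
    calc
      h * φ k = ((List.range (m + 1)).map fun i => (φ ^ i) h).prod := by
        rw [hk, List.range_succ_eq_map]; simp [List.map_map, Function.comp_def]
      _ = k * h := by rw [List.range_succ]; simp [k, hfix]
      _ = h * k := hhk.eq.symm

theorem GroupWord.val_eq_lift {G : Type*} [Group G] {ι : Type*} (s : ι → G) (w : GroupWord ι) :
    w.val s = FreeGroup.lift s (FreeGroup.mk w) :=
  FreeGroup.lift_mk.symm

theorem GroupWord.val_append {G : Type*} [Group G] {ι : Type*} (s : ι → G) (u v : GroupWord ι) :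
    (u ++ v : GroupWord ι).val s = u.val s * v.val s := by
  simp [GroupWord.val]

theorem GroupWord.val_cons {G : Type*} [Group G] {ι : Type*} (s : ι → G) (c : ι × Bool)
    (w : GroupWord ι) : GroupWord.val s (c :: w) = GroupWord.val s [c] * w.val s :=
  GroupWord.val_append s [c] w

theorem GroupWord.map_val {G H : Type*} [Group G] [Group H] (f : G →* H) {ι : Type*} (s : ι → G)
    (w : GroupWord ι) : f (w.val s) = w.val (f ∘ s) := by
  rw [val_eq_lift, val_eq_lift, ← MonoidHom.comp_apply]
  congr 1
  ext
  simp

namespace FreeByCyclic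

open FreeGroup hiding norm norm_mul_le IsReduced map_mul map_inv map_one
open SemidirectProduct

section Tree

variable {α : Type*} [DecidableEq α] {a b c p : FreeGroup α}

/-- The word metric `|a⁻¹ b|` of the free group, that is, the distance in the Cayley tree. -/
def treeDist (a b : FreeGroup α) : ℕ := (a⁻¹ * b).norm

theorem treeDist_self (a : FreeGroup α) : treeDist a a = 0 := by simp [treeDist]

theorem treeDist_one_left (a : FreeGroup α) : treeDist 1 a = a.norm := by simp [treeDist]

theorem treeDist_self_mul (a x : FreeGroup α) : treeDist a (a * x) = x.norm := by simp [treeDist]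

theorem treeDist_comm (a b : FreeGroup α) : treeDist a b = treeDist b a := by
  rw [treeDist, treeDist, ← norm_inv_eq, mul_inv_rev, inv_inv]

theorem treeDist_triangle (a b c : FreeGroup α) : treeDist a c ≤ treeDist a b + treeDist b c := by
  simpa [treeDist, mul_assoc] using FreeGroup.norm_mul_le (a⁻¹ * b) (b⁻¹ * c)

theorem treeDist_mul_left (g a b : FreeGroup α) : treeDist (g * a) (g * b) = treeDist a b := by
  simp [treeDist, mul_assoc]

theorem eq_of_treeDist_eq_zero (h : treeDist a b = 0) : a = b :=
  inv_mul_eq_one.1 (norm_eq_zero.1 h)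

/-- `p` lies on the geodesic from `a` to `b` in the Cayley tree. -/
def IsBetween (a p b : FreeGroup α) : Prop :=
  treeDist a p + treeDist p b = treeDist a b

theorem exists_common_prefix {β : Type*} (l₁ l₂ : List β) :
    ∃ q s₁ s₂, l₁ = q ++ s₁ ∧ l₂ = q ++ s₂ ∧ ∀ x ∈ s₁.head?, x ∉ s₂.head? := by
  induction l₁ generalizing l₂ with
  | nil => exact ⟨[], [], l₂, by simp⟩
  | cons x l₁ ih =>
    rcases l₂ with _ | ⟨y, l₂⟩
    · exact ⟨[], x :: l₁, [], by simp⟩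
    · obtain rfl | hxy := eq_or_ne x y
      · obtain ⟨q, s₁, s₂, rfl, rfl, h⟩ := ih l₂
        exact ⟨x :: q, s₁, s₂, rfl, rfl, h⟩
      · exact ⟨[], x :: l₁, y :: l₂, by simpa using hxy.symm⟩

theorem treeDist_add_le_of_prefix {q : List (α × Bool)} (ha : q <+: a.toWord)
    (hb : q <+: b.toWord) : treeDist a b + 2 * q.length ≤ a.norm + b.norm := by
  have treeDist_mk {x : FreeGroup α} (hx : q <+: x.toWord) :
      treeDist (mk q) x + q.length ≤ x.norm := by
    obtain ⟨s, hs⟩ := hx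
    have hx : x = mk q * mk s := by rw [mul_mk, hs, mk_toWord]
    have hle : treeDist (mk q) x ≤ s.length := by
      rw [hx, treeDist_self_mul]
      exact norm_mk_le
    have hlen : x.norm = q.length + s.length := by rw [FreeGroup.norm, ← hs, List.length_append]
    lia
  linarith [treeDist_triangle a (mk q) b, treeDist_comm a (mk q), treeDist_mk ha, treeDist_mk hb]

theorem isReduced_invRev_append {β : Type*} {s t : List (β × Bool)}
    (hs : FreeGroup.IsReduced s) (ht : FreeGroup.IsReduced t)
    (hst : ∀ x ∈ s.head?, x ∉ t.head?) : FreeGroup.IsReduced (invRev s ++ t) := by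
  classical
  have hs' : FreeGroup.IsReduced (invRev s) := by
    have := isReduced_toWord (x := (mk s)⁻¹)
    rwa [toWord_inv, toWord_mk, hs.reduce_eq] at this
  refine List.isChain_append.2 ⟨hs', ht, fun x hx y hy hxy => ?_⟩
  obtain ⟨z, hz, rfl⟩ : ∃ z ∈ s.head?, x = (z.1, !z.2) := by
    simpa [invRev, eq_comm] using hx
  by_contra hne
  have hzy : z = y := Prod.ext hxy (by simpa using hne)
  exact hst z hz (hzy ▸ hy)

theorem exists_prefix_treeDist_add_eq (a b : FreeGroup α) :
    ∃ q, q <+: a.toWord ∧ q <+: b.toWord ∧ treeDist a b + 2 * q.length = a.norm + b.norm := by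
  obtain ⟨q, s, t, ha, hb, hst⟩ := exists_common_prefix a.toWord b.toWord
  refine ⟨q, ⟨s, ha.symm⟩, ⟨t, hb.symm⟩, ?_⟩
  have reduced_suffix {x : FreeGroup α} {r} (hx : x.toWord = q ++ r) : FreeGroup.IsReduced r :=
    (hx ▸ isReduced_toWord).infix (List.suffix_append q r).isInfix
  have hred : FreeGroup.IsReduced (invRev s ++ t) :=
    isReduced_invRev_append (reduced_suffix ha) (reduced_suffix hb) hst
  have hab : a⁻¹ * b = mk (invRev s ++ t) := by
    rw [← mk_toWord (x := a), ← mk_toWord (x := b), ha, hb, ← mul_mk, ← mul_mk, ← mul_mk,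
      ← inv_mk]
    group
  have hnorm : treeDist a b = s.length + t.length := by
    rw [treeDist, hab, FreeGroup.norm, toWord_mk, hred.reduce_eq, List.length_append,
      invRev_length]
  simp only [hnorm, FreeGroup.norm, ha, hb, List.length_append]
  lia

theorem treeDist_add_norm_le_max (a b c : FreeGroup α) :
    treeDist a c + b.norm ≤ max (treeDist a b + c.norm) (a.norm + treeDist b c) := by
  obtain ⟨q, hqa, hqb, hq⟩ := exists_prefix_treeDist_add_eq a b
  obtain ⟨r, hrb, hrc, hr⟩ := exists_prefix_treeDist_add_eq b c
  rcases List.prefix_or_prefix_of_prefix hqb hrb with h | h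
  · have := treeDist_add_le_of_prefix hqa (h.trans hrc)
    lia
  · have := treeDist_add_le_of_prefix (h.trans hqa) hrc
    lia

theorem treeDist_four_point (a b c d : FreeGroup α) :
    treeDist a c + treeDist b d ≤
      max (treeDist a b + treeDist c d) (treeDist a d + treeDist b c) := by
  have := treeDist_add_norm_le_max (d⁻¹ * a) (d⁻¹ * b) (d⁻¹ * c)
  simp only [treeDist_mul_left] at this
  rwa [treeDist_comm b d, treeDist_comm c d, treeDist_comm a d]

theorem IsBetween.or (h : IsBetween a p b) (c : FreeGroup α) :
    IsBetween a p c ∨ IsBetween c p b := by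
  have := treeDist_four_point a p b c
  have := treeDist_triangle a p c
  have := treeDist_triangle c p b
  simp only [IsBetween, treeDist_comm c] at *
  lia

theorem IsBetween.symm (h : IsBetween a p b) : IsBetween b p a := by
  rw [IsBetween, treeDist_comm b a, ← h, treeDist_comm b, treeDist_comm p a, add_comm]

theorem exists_isBetween {k : ℕ} (hk : k ≤ treeDist a b) :
    ∃ p, IsBetween a p b ∧ treeDist a p = k := by
  let L := (a⁻¹ * b).toWord
  let p := a * mk (L.take k)
  have hb : p * mk (L.drop k) = b := by
    rw [mul_assoc, mul_mk, List.take_append_drop, mk_toWord, mul_inv_cancel_left]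
  have hap : treeDist a p ≤ k := by
    rw [treeDist_self_mul]
    exact norm_mk_le.trans (List.length_take_le _ _)
  have hpb : treeDist p b ≤ treeDist a b - k := by
    rw [← hb, treeDist_self_mul, hb]
    exact norm_mk_le.trans List.length_drop.le
  have := treeDist_triangle a p b
  exact ⟨p, by rw [IsBetween]; lia, by lia⟩

end Tree

section Lipschitz

variable {α β : Type*} [DecidableEq α] [DecidableEq β]

theorem IsBetween.trans_left {a c b q : FreeGroup α} (hc : IsBetween a c b)
    (hq : IsBetween c q b) : IsBetween a q b := by
  have := treeDist_triangle a c q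
  have := treeDist_triangle a q b
  simp only [IsBetween] at *
  lia

/-- The path from `f a` to `f b` traced by a Lipschitz map advances by jumps of bounded length, and
a jump over a point of a tree starts near that point. -/
theorem exists_isBetween_treeDist_map_le {f : FreeGroup α → FreeGroup β} {K : ℕ}
    (hf : ∀ x y, treeDist (f x) (f y) ≤ K * treeDist x y) {a b : FreeGroup α} {p : FreeGroup β}
    (h : IsBetween (f a) p (f b)) : ∃ q, IsBetween a q b ∧ treeDist p (f q) ≤ K := by
  induction hn : treeDist a b generalizing a with
  | zero =>
    obtain rfl := eq_of_treeDist_eq_zero hn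
    refine ⟨a, by simp [IsBetween, treeDist_self], ?_⟩
    rw [IsBetween, treeDist_self] at h
    lia
  | succ n ih =>
    obtain ⟨c, hc, hac⟩ := exists_isBetween (a := a) (b := b) (k := 1) (by lia)
    rcases h.or (f c) with h | h
    · refine ⟨c, hc, ?_⟩
      have := hf a c
      rw [hac, ← h] at this
      lia
    · obtain ⟨q, hq, hpq⟩ := ih h (by rw [IsBetween] at hc; lia)
      exact ⟨q, hc.trans_left hq, hpq⟩

theorem exists_norm_map_le [Finite α] (f : FreeGroup α →* FreeGroup β) :
    ∃ K, ∀ x, (f x).norm ≤ K * x.norm := by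
  obtain ⟨K, hK⟩ := Finite.exists_le fun a => (f (of a)).norm
  have hword (L : List (α × Bool)) : (f (mk L)).norm ≤ K * L.length := by
    induction L with
    | nil => simp [← one_eq_mk]
    | cons a L ih =>
      have ha : (f (mk [a])).norm ≤ K := by
        rcases a with ⟨a, _ | _⟩
        · have : mk [(a, false)] = (of a)⁻¹ := rfl
          simpa [this] using hK a
        · exact hK a
      calc (f (mk (a :: L))).norm = (f (mk [a]) * f (mk L)).norm := by
            rw [← map_mul, mul_mk, List.singleton_append]
        _ ≤ K + K * L.length := (FreeGroup.norm_mul_le _ _).trans (add_le_add ha ih)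
        _ = K * (a :: L).length := by rw [List.length_cons]; ring
  refine ⟨K, fun x => ?_⟩
  have := hword x.toWord
  rwa [mk_toWord] at this

theorem exists_treeDist_map_le [Finite α] (f : FreeGroup α →* FreeGroup β) :
    ∃ K, ∀ x y, treeDist (f x) (f y) ≤ K * treeDist x y := by
  obtain ⟨K, hK⟩ := exists_norm_map_le f
  exact ⟨K, fun x y => by simpa [treeDist] using hK (x⁻¹ * y)⟩

/-- Cooper's bounded cancellation lemma, for automorphisms. -/
theorem exists_treeDist_map_add_le [Finite α] (ψ : MulAut (FreeGroup α)) :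
    ∃ C, ∀ a p b, IsBetween a p b →
      treeDist (ψ a) (ψ p) + treeDist (ψ p) (ψ b) ≤ treeDist (ψ a) (ψ b) + C := by
  obtain ⟨K, hK⟩ := exists_treeDist_map_le ψ.toMonoidHom
  obtain ⟨K', hK'⟩ := exists_treeDist_map_le ψ⁻¹.toMonoidHom
  refine ⟨2 * (K * K'), fun a p b h => ?_⟩
  obtain ⟨q, hq, hpq⟩ := exists_isBetween_treeDist_map_le hK' (a := ψ a) (b := ψ b) (p := p)
    (by simpa using h)
  have hψpq : treeDist (ψ p) q ≤ K * K' := by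
    have := (hK p (ψ⁻¹ q)).trans (Nat.mul_le_mul_left K hpq)
    simpa using this
  have hap := treeDist_triangle (ψ a) q (ψ p)
  have hpb := treeDist_triangle (ψ p) q (ψ b)
  rw [IsBetween] at hq
  linarith [treeDist_comm q (ψ p)]

/-- A point almost minimising the largest `δ`-distance to the points `o i` is close to a minimiser:
`δ` is almost additive along geodesics, so at the midpoint of the two that distance would drop. -/
theorem treeDist_le_of_sup_le {δ : FreeGroup α → FreeGroup α → ℕ} {C C' : ℕ}
    (hδ : ∀ a b, treeDist a b ≤ δ a b)
    (hC : ∀ a p b, IsBetween a p b → δ a p + δ p b ≤ δ a b + C)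
    {ι : Type*} {s : Finset ι} (hs : s.Nonempty) {o : ι → FreeGroup α} {g g' : FreeGroup α}
    (hg : ∀ x, (s.sup fun i => δ (o i) g) ≤ s.sup fun i => δ (o i) x)
    (hg' : (s.sup fun i => δ (o i) g') ≤ (s.sup fun i => δ (o i) g) + C') :
    treeDist g g' ≤ 2 * (C + C') + 1 := by
  obtain ⟨p, hp, hgp⟩ := exists_isBetween (Nat.div_le_self (treeDist g g') 2)
  obtain ⟨i, hi, hip⟩ := s.exists_mem_eq_sup hs fun i => δ (o i) p
  have hmin := hg p
  rcases hp.or (o i) with h | h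
  · have := hC (o i) p g h.symm
    have := s.le_sup (f := fun i => δ (o i) g) hi
    have := hδ p g
    rw [treeDist_comm p] at this
    lia
  · have := hC (o i) p g' h
    have := s.le_sup (f := fun i => δ (o i) g') hi
    have := hδ p g'
    rw [IsBetween] at hp
    lia

end Lipschitz

section Translation

variable {α : Type*} [DecidableEq α]

theorem norm_lt_norm_mul_self {u : FreeGroup α} (hu : u ≠ 1) : u.norm < (u * u).norm := by
  have hsq := reduceCyclically.reduce_flatten_replicate_succ (isReduced_toWord (x := u)) 1
  have hconj := reduceCyclically.conj_conjugator_reduceCyclically u.toWord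
  have hne : reduceCyclically u.toWord ≠ [] := by
    intro h
    apply hu
    rw [h, List.append_nil] at hconj
    rw [← mk_toWord (x := u), ← hconj, ← mul_mk, ← inv_mk, mul_inv_cancel]
  have hpos := List.length_pos_iff.2 hne
  have hsq := congrArg List.length hsq
  have hconj := congrArg List.length hconj
  simp only [FreeGroup.norm, toWord_mul, List.replicate_succ, List.replicate_zero,
    List.flatten_cons, List.flatten_nil, List.append_nil, List.length_append, invRev_length] at *
  lia

/-- A shortest `x` among the `u ^ k * g` works: it satisfies `u * x = x * v`, so if it were longer
than `|u| + |v|` it would be equidistant from `u⁻¹`, `1` and `u`, which forces `|u²| ≤ |u|`. -/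
theorem exists_norm_zpow_mul_le {u v g : FreeGroup α} (hu : u ≠ 1) (h : SemiconjBy g v u) :
    ∃ k : ℤ, (u ^ k * g).norm ≤ u.norm + v.norm := by
  obtain ⟨k, hk⟩ : ∃ k : ℤ, ∀ j : ℤ, (u ^ k * g).norm ≤ (u ^ j * g).norm :=
    ⟨_, fun j => Function.argmin_le (fun k : ℤ => (u ^ k * g).norm) j⟩
  refine ⟨k, ?_⟩
  set x := u ^ k * g with hx
  have hxv : u * x = x * v := (SemiconjBy.mul_left (Commute.zpow_self u k) h).symm
  have hux : x.norm ≤ treeDist 1 (u * x) := by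
    rw [treeDist_one_left, hx, ← mul_assoc, ← zpow_one_add]
    exact hk _
  have hux' : x.norm ≤ treeDist u x := by
    rw [treeDist, hx, ← mul_assoc, ← zpow_neg_one, ← zpow_add]
    exact hk _
  have hsq : treeDist u u⁻¹ = (u * u).norm := by
    rw [treeDist, ← norm_inv_eq]; simp
  have h₁ := treeDist_four_point 1 u (u * x) x
  have h₂ := treeDist_four_point 1 u x u⁻¹
  have hlt := norm_lt_norm_mul_self hu
  rw [treeDist_self_mul, treeDist_comm (u * x), hxv, treeDist_self_mul, ← hxv] at h₁
  rw [hsq, treeDist_comm x] at h₂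
  have : treeDist u⁻¹ x = treeDist 1 (u * x) := by simp [treeDist]
  simp only [treeDist_one_left, norm_inv_eq] at *
  lia

end Translation

section TwistDist

variable {α : Type*} [DecidableEq α] {ψ : MulAut (FreeGroup α)} {p : ℕ}

/-- The sum of the tree metric over `1, ψ, …, ψ ^ (p - 1)`. When `ψ ^ p` is inner this is a
left-invariant metric that `ψ` preserves up to a bounded error. -/
def twistDist (ψ : MulAut (FreeGroup α)) (p : ℕ) (a b : FreeGroup α) : ℕ :=
  ∑ j ∈ Finset.range p, treeDist ((ψ ^ j) a) ((ψ ^ j) b)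

theorem treeDist_le_twistDist (hp : 0 < p) (a b : FreeGroup α) :
    treeDist a b ≤ twistDist ψ p a b :=
  Finset.single_le_sum (f := fun j => treeDist ((ψ ^ j) a) ((ψ ^ j) b)) (fun _ _ => Nat.zero_le _)
    (Finset.mem_range.2 hp)

theorem twistDist_triangle (a b c : FreeGroup α) :
    twistDist ψ p a c ≤ twistDist ψ p a b + twistDist ψ p b c := by
  simp only [twistDist, ← Finset.sum_add_distrib]
  exact Finset.sum_le_sum fun _ _ => treeDist_triangle _ _ _

theorem twistDist_self (a : FreeGroup α) : twistDist ψ p a a = 0 := by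
  simp [twistDist, treeDist_self]

theorem twistDist_mul_left (g a b : FreeGroup α) :
    twistDist ψ p (g * a) (g * b) = twistDist ψ p a b := by
  simp only [twistDist, map_mul, treeDist_mul_left]

theorem twistDist_map_le {h : FreeGroup α} (hψ : ψ ^ p = MulAut.conj h) (a b : FreeGroup α) :
    twistDist ψ p (ψ a) (ψ b) ≤ twistDist ψ p a b + 2 * h.norm := by
  have hshift : twistDist ψ p (ψ a) (ψ b) + treeDist a b =
      twistDist ψ p a b + treeDist ((ψ ^ p) a) ((ψ ^ p) b) := by
    have := (Finset.sum_range_succ' (fun j => treeDist ((ψ ^ j) a) ((ψ ^ j) b)) p).symm.trans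
      (Finset.sum_range_succ _ p)
    simpa only [twistDist, pow_succ, MulAut.mul_apply, pow_zero, MulAut.one_apply] using this
  have hconj : treeDist ((ψ ^ p) a) ((ψ ^ p) b) ≤ treeDist a b + 2 * h.norm := calc
    treeDist ((ψ ^ p) a) ((ψ ^ p) b) = (h * (a⁻¹ * b) * h⁻¹).norm := by
      simp [treeDist, hψ, mul_assoc]
    _ ≤ h.norm + treeDist a b + h⁻¹.norm :=
      (FreeGroup.norm_mul_le _ _).trans (Nat.add_le_add_right (FreeGroup.norm_mul_le _ _) _)
    _ = treeDist a b + 2 * h.norm := by rw [norm_inv_eq]; ring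
  lia

theorem exists_twistDist_add_le [Finite α] (ψ : MulAut (FreeGroup α)) (p : ℕ) :
    ∃ C, ∀ a q b, IsBetween a q b →
      twistDist ψ p a q + twistDist ψ p q b ≤ twistDist ψ p a b + C := by
  choose C hC using fun j => exists_treeDist_map_add_le (ψ ^ j)
  refine ⟨∑ j ∈ Finset.range p, C j, fun a q b h => ?_⟩
  simp only [twistDist, ← Finset.sum_add_distrib]
  exact Finset.sum_le_sum fun j _ => hC j a q b h

theorem exists_twistDist_le [Finite α] (ψ : MulAut (FreeGroup α)) (p : ℕ) :
    ∃ K, ∀ a b, twistDist ψ p a b ≤ K * treeDist a b := by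
  choose K hK using fun j => exists_treeDist_map_le (ψ ^ j).toMonoidHom
  refine ⟨∑ j ∈ Finset.range p, K j, fun a b => ?_⟩
  rw [Finset.sum_mul]
  exact Finset.sum_le_sum fun j _ => hK j a b

end TwistDist

section FiniteOrder

theorem left_pow_succ {F C : Type*} [Group F] [Group C] {θ : C →* MulAut F} (x : F ⋊[θ] C) (i : ℕ) :
    (x ^ (i + 1)).left = x.left * θ x.right (x ^ i).left := by
  rw [pow_succ', mul_left]

variable {α : Type*} [DecidableEq α] {C : Type*} [Group C] {θ : C →* MulAut (FreeGroup α)}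

theorem exists_norm_left_pow_le [Finite α] (c : C) (p : ℕ) :
    ∃ A, ∀ x : FreeGroup α ⋊[θ] C, x.right = c → ∀ i < p, (x ^ i).left.norm ≤ A * x.left.norm := by
  obtain ⟨K, hK⟩ := exists_norm_map_le (θ c).toMonoidHom
  induction p with
  | zero => exact ⟨0, by simp⟩
  | succ p ih =>
    obtain ⟨A, hA⟩ := ih
    refine ⟨1 + K * A, fun x hx i hi => ?_⟩
    rcases i with _ | i
    · simp
    · rw [left_pow_succ, hx]
      calc (x.left * θ c (x ^ i).left).norm ≤ x.left.norm + (θ c (x ^ i).left).norm :=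
            FreeGroup.norm_mul_le _ _
        _ ≤ x.left.norm + K * (A * x.left.norm) := by
          gcongr
          exact (hK _).trans (Nat.mul_le_mul_left _ (hA x hx i (by lia)))
        _ = (1 + K * A) * x.left.norm := by ring

/-- The orbit of `1` under `a ↦ x.left * θ c a` closes up after `p` steps, up to `h`. -/
theorem sup_twistDist_le {c : C} {p : ℕ} {h : FreeGroup α} (hp : 0 < p)
    (hc : θ c ^ p = MulAut.conj h) {x : FreeGroup α ⋊[θ] C} (hxc : x.right = c)
    (hxp : (x ^ p).left = h⁻¹) (g : FreeGroup α) :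
    ((Finset.range p).sup fun i => twistDist (θ c) p (x ^ i).left (x.left * θ c g)) ≤
      ((Finset.range p).sup fun i => twistDist (θ c) p (x ^ i).left g) +
        (twistDist (θ c) p 1 h⁻¹ + 2 * h.norm) := by
  refine Finset.sup_le fun i hi => ?_
  obtain ⟨j, hj, hij⟩ : ∃ j < p, twistDist (θ c) p (x ^ i).left (x ^ (j + 1)).left ≤
      twistDist (θ c) p 1 h⁻¹ := by
    rcases i with _ | i
    · refine ⟨p - 1, by lia, ?_⟩
      rw [Nat.sub_add_cancel hp, hxp, pow_zero, one_left]
    · exact ⟨i, by rw [Finset.mem_range] at hi; lia, by simp [twistDist_self]⟩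
  have hstep : twistDist (θ c) p (x ^ (j + 1)).left (x.left * θ c g) ≤
      twistDist (θ c) p (x ^ j).left g + 2 * h.norm := by
    rw [left_pow_succ, hxc, twistDist_mul_left]
    exact twistDist_map_le hc _ _
  have hle := Finset.le_sup (f := fun i => twistDist (θ c) p (x ^ i).left g) (Finset.mem_range.2 hj)
  have := twistDist_triangle (ψ := θ c) (p := p) (x ^ i).left (x ^ (j + 1)).left (x.left * θ c g)
  lia

/-- The orbit of `1` under `a ↦ x.left * θ c a` has a quasi-centre `g`, which that map moves by a
bounded amount; conjugating by `g` brings it to the origin. -/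
theorem exists_semiconjBy_norm_left_le [Finite α] {c : C} {p : ℕ} {h : FreeGroup α} (hp : 0 < p)
    (hc : θ c ^ p = MulAut.conj h) :
    ∃ A D, ∀ x : FreeGroup α ⋊[θ] C, x.right = c → (x ^ p).left = h⁻¹ →
      ∃ g y, SemiconjBy (inl g) y x ∧ g.norm ≤ A * x.left.norm ∧ y.left.norm ≤ D := by
  obtain ⟨B, hB⟩ := exists_twistDist_add_le (θ c) p
  obtain ⟨K, hK⟩ := exists_twistDist_le (θ c) p
  obtain ⟨A, hA⟩ := exists_norm_left_pow_le (θ := θ) c p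
  refine ⟨K * A, 2 * (B + (twistDist (θ c) p 1 h⁻¹ + 2 * h.norm)) + 1, fun x hxc hxp => ?_⟩
  let r (y : FreeGroup α) : ℕ := (Finset.range p).sup fun i => twistDist (θ c) p (x ^ i).left y
  obtain ⟨g, hg⟩ : ∃ g, ∀ y, r g ≤ r y := ⟨_, fun y => Function.argmin_le r y⟩
  refine ⟨g, (inl g)⁻¹ * x * inl g, ?_, ?_, ?_⟩
  · rw [SemiconjBy, mul_assoc, mul_inv_cancel_left]
  · calc g.norm = treeDist 1 g := (treeDist_one_left g).symm
      _ ≤ twistDist (θ c) p 1 g := treeDist_le_twistDist hp 1 g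
      _ ≤ r g := by
        simpa using Finset.le_sup (f := fun i => twistDist (θ c) p (x ^ i).left g)
          (Finset.mem_range.2 hp)
      _ ≤ r 1 := hg 1
      _ ≤ K * A * x.left.norm := Finset.sup_le fun i hi => by
        refine (hK _ _).trans ?_
        rw [treeDist_comm, treeDist_one_left, mul_assoc]
        exact Nat.mul_le_mul_left K (hA x hxc i (Finset.mem_range.1 hi))
  · have hleft : ((inl g)⁻¹ * x * inl g).left = g⁻¹ * (x.left * θ c g) := by
      simp [← map_inv, hxc, mul_assoc]
    rw [hleft]
    exact treeDist_le_of_sup_le (treeDist_le_twistDist hp) hB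
      (Finset.nonempty_range_iff.2 hp.ne') hg
      (sup_twistDist_le hp hc hxc hxp g)

end FiniteOrder

section LeftPow

variable {F C : Type*} [Group F] [Group C] {θ : C →* MulAut F} {p : ℕ} {h : F}

theorem map_right_pow (x : F ⋊[θ] C) (p : ℕ) : θ (x ^ p).right = θ x.right ^ p := by
  rw [← rightHom_eq_right, map_pow, rightHom_eq_right, map_pow]

/-- The element `x ^ p` acts on the normal subgroup as conjugation by `(x ^ p).left * h`. -/
theorem commute_inl_left_pow_mul {x : F ⋊[θ] C} (hx : θ x.right ^ p = MulAut.conj h)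
    (hfix : θ x.right h = h) : Commute (inl ((x ^ p).left * h)) x := by
  have hconj : θ (x ^ p).right x.left * h = h * x.left := by
    rw [map_right_pow, hx, MulAut.conj_apply, inv_mul_cancel_right]
  refine SemidirectProduct.ext ?_ (by simp)
  calc (inl ((x ^ p).left * h) * x).left = (x ^ p).left * θ (x ^ p).right x.left * h := by
        simp [mul_assoc, hconj]
    _ = (x ^ (p + 1)).left * h := by rw [pow_succ, mul_left]
    _ = (x * inl ((x ^ p).left * h)).left := by simp [pow_succ', hfix, mul_assoc]

theorem right_eq_of_semiconjBy_inl {g : F} {x y : F ⋊[θ] C} (h : SemiconjBy (inl g) x y) :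
    x.right = y.right := by
  simpa using congrArg SemidirectProduct.right h.eq

theorem semiconjBy_left_pow_mul {g : F} {x y : F ⋊[θ] C} (hx : θ x.right ^ p = MulAut.conj h)
    (hg : SemiconjBy (inl g) x y) : SemiconjBy g ((x ^ p).left * h) ((y ^ p).left * h) := by
  have hconj : θ (y ^ p).right g = h * g * h⁻¹ := by
    rw [map_right_pow, ← right_eq_of_semiconjBy_inl hg, hx, MulAut.conj_apply]
  have hleft := congrArg SemidirectProduct.left (hg.pow_right p).eq
  simp only [mul_left, left_inl, right_inl, map_one, MulAut.one_apply, hconj] at hleft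
  rw [SemiconjBy, ← mul_assoc, hleft]
  group

end LeftPow

theorem exists_bound_witness {X Y : Type*} {s : Set X} (hs : s.Finite) (P : X → Y → Prop)
    (f : Y → ℕ) : ∃ M, ∀ x ∈ s, (∃ y, P x y) → ∃ y, P x y ∧ f y ≤ M := by
  have hN (x : X) : ∃ n, (∃ y, P x y) → ∃ y, P x y ∧ f y ≤ n := by
    by_cases hx : ∃ y, P x y
    · obtain ⟨y, hy⟩ := hx
      exact ⟨f y, fun _ => ⟨y, hy, le_rfl⟩⟩
    · exact ⟨0, fun h => absurd h hx⟩
  choose N hN using hN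
  obtain ⟨M, hM⟩ := (hs.image N).bddAbove
  refine ⟨M, fun x hx h => ?_⟩
  obtain ⟨y, hy, hle⟩ := hN x h
  exact ⟨y, hy, hle.trans (hM (Set.mem_image_of_mem N hx))⟩

section SameFibre

variable {α : Type*} [DecidableEq α] {C : Type*} [Group C] {θ : C →* MulAut (FreeGroup α)}

theorem finite_setOf_norm_left_le [Finite α] (c : C) (D : ℕ) :
    {x : FreeGroup α ⋊[θ] C | x.right = c ∧ x.left.norm ≤ D}.Finite := by
  have hball : {a : FreeGroup α | a.norm ≤ D}.Finite :=
    (List.finite_length_le (α × Bool) D).preimage toWord_injective.injOn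
  refine (hball.image fun a => (⟨a, c⟩ : FreeGroup α ⋊[θ] C)).subset ?_
  rintro x ⟨rfl, hx⟩
  exact ⟨x.left, hx, rfl⟩

theorem exists_semiconjBy_inl_norm_le_of_left_pow_eq [Finite α] {c : C} {p : ℕ} {h : FreeGroup α}
    (hp : 0 < p) (hc : θ c ^ p = MulAut.conj h) :
    ∃ A, ∀ (x y : FreeGroup α ⋊[θ] C) (g : FreeGroup α), x.right = c → SemiconjBy (inl g) x y →
      (x ^ p).left = h⁻¹ → (y ^ p).left = h⁻¹ →
        ∃ g', SemiconjBy (inl g') x y ∧ g'.norm ≤ A * (x.left.norm + y.left.norm + 1) := by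
  obtain ⟨B, D, hBD⟩ := exists_semiconjBy_norm_left_le hp hc
  let S : Set (FreeGroup α ⋊[θ] C) := {x | x.right = c ∧ x.left.norm ≤ D}
  have hS : S.Finite := finite_setOf_norm_left_le c D
  obtain ⟨M, hM⟩ := exists_bound_witness (hS.prod hS)
    (fun z g => SemiconjBy (inl g) z.1 z.2) FreeGroup.norm
  refine ⟨B + M, fun x y g hx hg hxp hyp => ?_⟩
  have hy : y.right = c := (right_eq_of_semiconjBy_inl hg).symm.trans hx
  obtain ⟨a, x₀, ha, hna, hx₀⟩ := hBD x hx hxp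
  obtain ⟨b, y₀, hb, hnb, hy₀⟩ := hBD y hy hyp
  have hab : SemiconjBy (inl (b⁻¹ * (g * a))) x₀ y₀ := by
    rw [map_mul, map_mul, map_inv]
    exact SemiconjBy.mul_left (SemiconjBy.inv_symm_left_iff.2 hb) (hg.mul_left ha)
  have hx₀S : x₀ ∈ S := ⟨(right_eq_of_semiconjBy_inl ha).trans hx, hx₀⟩
  have hy₀S : y₀ ∈ S := ⟨(right_eq_of_semiconjBy_inl hb).trans hy, hy₀⟩
  obtain ⟨e, he, hne⟩ := hM (x₀, y₀) ⟨hx₀S, hy₀S⟩ ⟨_, hab⟩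
  refine ⟨b * (e * a⁻¹), ?_, ?_⟩
  · rw [map_mul, map_mul, map_inv]
    exact hb.mul_left (SemiconjBy.mul_left he (SemiconjBy.inv_symm_left_iff.2 ha))
  · have h₁ := FreeGroup.norm_mul_le b (e * a⁻¹)
    have h₂ := FreeGroup.norm_mul_le e a⁻¹
    rw [norm_inv_eq] at h₂
    nlinarith

theorem exists_semiconjBy_inl_norm_le [Finite α] {c : C} {p : ℕ} {h : FreeGroup α} (hp : 0 < p)
    (hc : θ c ^ p = MulAut.conj h) (hfix : θ c h = h) :
    ∃ A, ∀ (x y : FreeGroup α ⋊[θ] C) (g : FreeGroup α), x.right = c → SemiconjBy (inl g) x y →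
      ∃ g', SemiconjBy (inl g') x y ∧ g'.norm ≤ A * (x.left.norm + y.left.norm + 1) := by
  obtain ⟨A, hA⟩ := exists_norm_left_pow_le (θ := θ) c (p + 1)
  obtain ⟨B, hB⟩ := exists_semiconjBy_inl_norm_le_of_left_pow_eq hp hc
  refine ⟨A + B + 2 * h.norm, fun x y g hx hg => ?_⟩
  have hy : y.right = c := (right_eq_of_semiconjBy_inl hg).symm.trans hx
  have hu := semiconjBy_left_pow_mul (h := h) (by rwa [hx]) hg
  by_cases huy : (y ^ p).left * h = 1
  · have hux : (x ^ p).left * h = 1 := by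
      rw [huy] at hu
      simpa using hu.eq
    obtain ⟨g', hg', hle⟩ :=
      hB x y g hx hg (eq_inv_of_mul_eq_one_left hux) (eq_inv_of_mul_eq_one_left huy)
    exact ⟨g', hg', hle.trans (Nat.mul_le_mul_right _ (by lia))⟩
  · obtain ⟨k, hk⟩ := exists_norm_zpow_mul_le huy hu
    refine ⟨((y ^ p).left * h) ^ k * g, ?_, hk.trans ?_⟩
    · rw [map_mul, map_zpow]
      refine SemiconjBy.mul_left ?_ hg
      exact (commute_inl_left_pow_mul (by rwa [hy]) (by rwa [hy])).zpow_left k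
    · have h₁ := FreeGroup.norm_mul_le (x ^ p).left h
      have h₂ := FreeGroup.norm_mul_le (y ^ p).left h
      have h₃ := hA x hx p p.lt_succ_self
      have h₄ := hA y hy p p.lt_succ_self
      nlinarith

end SameFibre

theorem norm_zpow_le {α : Type*} [DecidableEq α] (x : FreeGroup α) (k : ℤ) :
    (x ^ k).norm ≤ k.natAbs * x.norm := by
  have hpow (n : ℕ) : (x ^ n).norm ≤ n * x.norm := by
    induction n with
    | zero => simp
    | succ n ih =>
      rw [pow_succ, add_one_mul]
      exact (FreeGroup.norm_mul_le _ _).trans (Nat.add_le_add_right ih _)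
  rcases k.eq_nat_or_neg with ⟨n, rfl | rfl⟩
  · simpa using hpow n
  · simpa using hpow n

section Center

variable {F C : Type*} [Group F] [Group C] {θ : C →* MulAut F} {t : C} {m : ℕ} {h : F}

theorem exists_central_of_pow_eq_conj (ht : ∀ c, c ∈ Subgroup.zpowers t)
    (hm : θ t ^ m = MulAut.conj h) (hfix : θ t h = h) :
    ∃ z : F ⋊[θ] C, (∀ w, Commute z w) ∧ z.right = t ^ m ∧
      ∀ (q : ℤ) (x : F ⋊[θ] C), (x * z ^ q).left = x.left * h ^ (-q) := by
  have hfix_all (c : C) : θ c h = h := by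
    obtain ⟨k, rfl⟩ := ht c
    have : θ t ∈ MulAction.stabilizer (MulAut F) h := hfix
    have := zpow_mem this k
    rwa [← map_zpow] at this
  let z : F ⋊[θ] C := ⟨h⁻¹, t ^ m⟩
  have hz_inl (g : F) : Commute z (inl g) := by
    refine SemidirectProduct.ext ?_ (by simp)
    rw [mul_left, mul_left, left_inl, right_inl, map_one, MulAut.one_apply]
    change h⁻¹ * θ (t ^ m) g = g * h⁻¹
    rw [map_pow, hm, MulAut.conj_apply, ← mul_assoc, inv_mul_cancel_left]
  have hz_inr (c : C) : Commute z (inr c) := by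
    refine SemidirectProduct.ext ?_ ?_
    · rw [mul_left, mul_left, left_inr, right_inr, map_one, mul_one, one_mul,
        map_inv, hfix_all]
    · obtain ⟨k, rfl⟩ := ht c
      exact (Commute.pow_self t m).zpow_right k
  have hz (w : F ⋊[θ] C) : Commute z w := by
    rw [← inl_left_mul_inr_right w]
    exact (hz_inl w.left).mul_right (hz_inr w.right)
  refine ⟨z, hz, rfl, fun q x => ?_⟩
  have hzq : z ^ q = inl (h ^ (-q)) * inr ((t ^ m) ^ q) := by
    have hcomm : Commute z (inl h) := hz_inl h
    have hzh : z * inl h = inr (t ^ m) := SemidirectProduct.ext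
      (by rw [mul_left, left_inl, left_inr, hfix_all, inv_mul_cancel]) (mul_one _)
    rw [zpow_neg, map_inv, map_zpow, map_zpow, ← hzh, hcomm.mul_zpow, (hcomm.zpow_zpow q q).eq,
      inv_mul_cancel_left]
  rw [hzq, mul_left, mul_left, left_inl, left_inr, map_one, mul_one, map_zpow, hfix_all]

theorem right_mul_zpow_neg_ediv (hm : 0 < m) {z x : F ⋊[θ] C} {k : ℤ} (hz : z.right = t ^ m)
    (hx : x.right = t ^ k) : (x * z ^ (-(k / m))).right = t ^ (k % m).toNat := by
  have hzk : (z ^ (-(k / m))).right = (t ^ m) ^ (-(k / m)) := by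
    rw [← rightHom_eq_right, map_zpow, rightHom_eq_right, hz]
  rw [mul_right, hx, hzk, ← zpow_natCast, ← zpow_mul, ← zpow_add, ← zpow_natCast,
    Int.toNat_of_nonneg (Int.emod_nonneg k (by lia)), Int.emod_def]
  congr 1
  ring

end Center

section CyclicExtension

variable {α : Type*} [DecidableEq α] [Finite α] {C : Type*} [Group C]
  {θ : C →* MulAut (FreeGroup α)} {t : C} {m : ℕ} {h : FreeGroup α}

theorem exists_semiconjBy_inl_mul_inr_norm_le (c d : C) {p : ℕ} (hp : 0 < p)
    (hc : θ c ^ p = MulAut.conj h) (hfix : θ c h = h) :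
    ∃ A, ∀ (x y : FreeGroup α ⋊[θ] C) (g : FreeGroup α), d * x.right * d⁻¹ = c →
      SemiconjBy (inl g * inr d) x y → ∃ g', SemiconjBy (inl g' * inr d) x y ∧
        g'.norm ≤ A * (x.left.norm + y.left.norm + 1) := by
  obtain ⟨A, hA⟩ := exists_semiconjBy_inl_norm_le hp hc hfix
  obtain ⟨K, hK⟩ := exists_norm_map_le (θ d).toMonoidHom
  refine ⟨A * (K + 1), fun x y g hx hg => ?_⟩
  have hd : SemiconjBy (inr d) x (inr d * x * (inr d)⁻¹) := SemiconjBy.conj_mk _ _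
  have hg' : SemiconjBy (inl g) (inr d * x * (inr d)⁻¹) y := by
    have := hg.mul_left (SemiconjBy.inv_symm_left_iff.2 hd)
    rwa [mul_inv_cancel_right] at this
  obtain ⟨g', hg', hle⟩ := hA _ y g (by simpa using hx) hg'
  refine ⟨g', hg'.mul_left hd, hle.trans ?_⟩
  have hleft : (inr d * x * (inr d)⁻¹ : FreeGroup α ⋊[θ] C).left = θ d x.left := by
    simp [← map_inv]
  have := hK x.left
  rw [hleft, mul_assoc]
  refine Nat.mul_le_mul_left A ?_
  change (θ d x.left).norm ≤ _ at this
  nlinarith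

theorem exists_semiconjBy_norm_le_of_right_eq_pow (hm : 0 < m) (hconj : θ t ^ m = MulAut.conj h)
    (hfix : θ t h = h) :
    ∃ A, ∀ s < m, ∀ r < m, ∀ (x y : FreeGroup α ⋊[θ] C) (g : FreeGroup α), x.right = t ^ s →
      SemiconjBy (inl g * inr (t ^ r)) x y → ∃ g', SemiconjBy (inl g' * inr (t ^ r)) x y ∧
        g'.norm ≤ A * (x.left.norm + y.left.norm + 1) := by
  have hconj_pow (s : ℕ) : θ (t ^ s) ^ m = MulAut.conj (h ^ s) := by
    rw [map_pow, ← pow_mul, mul_comm, pow_mul, hconj, map_pow]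
  have hfix_pow (s : ℕ) : θ (t ^ s) (h ^ s) = h ^ s := by
    have : θ t ∈ MulAction.stabilizer (MulAut (FreeGroup α)) h := hfix
    have := pow_mem this s
    rw [← map_pow] at this
    rw [map_pow (θ (t ^ s)), show θ (t ^ s) h = h from this]
  choose A hA using fun s r : ℕ =>
    exists_semiconjBy_inl_mul_inr_norm_le (t ^ s) (t ^ r) hm (hconj_pow s) (hfix_pow s)
  obtain ⟨B, hB⟩ := Finite.exists_le fun i : Fin m × Fin m => A i.1 i.2
  refine ⟨B, fun s hs r hr x y g hx hg => ?_⟩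
  obtain ⟨g', hg', hle⟩ := hA s r x y g (by rw [hx, pow_mul_comm, mul_inv_cancel_right]) hg
  exact ⟨g', hg', hle.trans (Nat.mul_le_mul_right _ (hB (⟨s, hs⟩, ⟨r, hr⟩)))⟩

/-- Multiplying the two elements and the conjugator by powers of a central element over `t ^ m`
reduces to exponents of `t` between `0` and `m - 1`. -/
theorem exists_semiconjBy_norm_le (ht : ∀ c, c ∈ Subgroup.zpowers t) (hm : 0 < m)
    (hconj : θ t ^ m = MulAut.conj h) (hfix : θ t h = h) :
    ∃ A, ∀ (l : ℤ) (x y : FreeGroup α ⋊[θ] C), x.right = t ^ l → IsConj x y →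
      ∃ r < m, ∃ g, SemiconjBy (inl g * inr (t ^ r)) x y ∧
        g.norm ≤ A * (x.left.norm + y.left.norm + l.natAbs + 1) := by
  obtain ⟨z, hz, hzt, hzx⟩ := exists_central_of_pow_eq_conj ht hconj hfix
  obtain ⟨A, hA⟩ := exists_semiconjBy_norm_le_of_right_eq_pow hm hconj hfix
  have toNat_lt (k : ℤ) : (k % m).toNat < m := by
    have := Int.emod_lt_of_pos k (b := m) (by lia)
    lia
  refine ⟨A * (1 + 2 * h.norm), fun l x y hx hxy => ?_⟩
  obtain ⟨w, hw⟩ := isConj_iff.1 hxy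
  replace hw : SemiconjBy w x y := by rw [← hw]; exact SemiconjBy.conj_mk _ _
  obtain ⟨k, hk⟩ := ht w.right
  let w' := w * z ^ (-(k / m))
  have hw' : w' = inl w'.left * inr (t ^ (k % m).toNat) := by
    rw [← right_mul_zpow_neg_ediv hm hzt hk.symm, inl_left_mul_inr_right]
  have hcomm (w : FreeGroup α ⋊[θ] C) (q : ℤ) : Commute w (z ^ q) := (hz w).symm.zpow_right q
  have hshift : SemiconjBy w' (x * z ^ (-(l / m))) (y * z ^ (-(l / m))) :=
    (hw.mul_left (hcomm x _).symm).mul_right (hcomm w' _)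
  rw [hw'] at hshift
  obtain ⟨g, hg, hle⟩ := hA _ (toNat_lt l) _ (toNat_lt k) _ _ _
    (right_mul_zpow_neg_ediv hm hzt hx) hshift
  refine ⟨_, toNat_lt k, g, ?_, hle.trans ?_⟩
  · have := hg.mul_right (hcomm _ (l / m))
    simpa [mul_assoc] using this
  · rw [hzx, hzx, neg_neg]
    have h₁ := FreeGroup.norm_mul_le x.left (h ^ (l / m))
    have h₂ := FreeGroup.norm_mul_le y.left (h ^ (l / m))
    have h₃ : (h ^ (l / m)).norm ≤ (x.left.norm + y.left.norm + l.natAbs + 1) * h.norm :=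
      (norm_zpow_le h (l / m)).trans (Nat.mul_le_mul_right _
        ((Int.natAbs_ediv_le_natAbs l m).trans (by lia)))
    rw [mul_assoc]
    refine Nat.mul_le_mul_left A ?_
    rw [add_mul, one_mul, mul_right_comm, mul_assoc]
    lia

end CyclicExtension

theorem exists_groupWord_length_le {α G ι : Type*} [DecidableEq α] [Finite α] [Group G]
    {s : ι → G} (hs : Subgroup.closure (Set.range s) = ⊤) (f : FreeGroup α →* G) :
    ∃ K, ∀ x, ∃ w : GroupWord ι, w.val s = f x ∧ w.length ≤ K * x.norm := by
  classical
  choose σ hσ using fun a => lift_surjective_iff_closure_range_eq_top.2 hs (f (of a))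
  have hf : (lift s).comp (lift σ) = f := by
    ext a
    simp [hσ]
  obtain ⟨K, hK⟩ := exists_norm_map_le (lift σ)
  refine ⟨K, fun x => ⟨(lift σ x).toWord, ?_, hK x⟩⟩
  rw [GroupWord.val_eq_lift, mk_toWord, ← hf, MonoidHom.comp_apply]

theorem exists_groupWord_semiconjBy_length_le {α C ι : Type*} [DecidableEq α] [Finite α]
    [Group C] {θ : C →* MulAut (FreeGroup α)} {t : C} (ht : ∀ c, c ∈ Subgroup.zpowers t)
    (hθ : IsVirtuallyInner (θ t)) {s : ι → FreeGroup α ⋊[θ] C}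
    (hs : Subgroup.closure (Set.range s) = ⊤) :
    ∃ A, ∀ (l : ℤ) (x y : FreeGroup α ⋊[θ] C), x.right = t ^ l → IsConj x y →
      ∃ w : GroupWord ι, SemiconjBy (w.val s) x y ∧
        w.length ≤ A * (x.left.norm + y.left.norm + l.natAbs + 1) := by
  obtain ⟨m, hm, h, hconj, hfix⟩ := hθ.exists_pow_eq_conj
  obtain ⟨A, hA⟩ := exists_semiconjBy_norm_le ht hm hconj hfix
  obtain ⟨K, hK⟩ := exists_groupWord_length_le hs inl
  obtain ⟨M, hM⟩ := exists_groupWord_length_le hs (lift fun _ : Unit => inr t)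
  refine ⟨K * A + M * m, fun l x y hx hxy => ?_⟩
  obtain ⟨r, hr, g, hg, hle⟩ := hA l x y hx hxy
  obtain ⟨u, hu, hu_le⟩ := hK g
  obtain ⟨v, hv, hv_le⟩ := hM (of () ^ r)
  refine ⟨u ++ v, ?_, ?_⟩
  · rwa [GroupWord.val_append, hu, hv, map_pow, lift_apply_of, ← map_pow]
  · have hu_le' := hu_le.trans (Nat.mul_le_mul_left K hle)
    rw [norm_of_pow] at hv_le
    have hv_le' := hv_le.trans (Nat.mul_le_mul_left M hr.le)
    rw [List.length_append, add_mul, mul_assoc]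
    exact Nat.add_le_add hu_le' (hv_le'.trans (Nat.le_mul_of_pos_right _ (Nat.succ_pos _)))

section Primrec

variable {α : Type*} [DecidableEq α]

theorem reduce_eq_foldr (L : List (α × Bool)) :
    reduce L = L.foldr (fun a s =>
      List.casesOn s [a] fun b l => if a.1 = b.1 ∧ a.2 = !b.2 then l else a :: b :: l) [] := by
  induction L with
  | nil => rfl
  | cons a l ih => rw [reduce.cons, List.foldr_cons, ← ih]

theorem primrec_reduce [Primcodable α] :
    Primrec (reduce : List (α × Bool) → List (α × Bool)) := by
  let S := (α × Bool) × List (α × Bool)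
  have hcons : Primrec₂ fun (q : List (α × Bool) × S) (c : S) =>
      if q.2.1.1 = c.1.1 ∧ q.2.1.2 = !c.1.2 then c.2 else q.2.1 :: c.1 :: c.2 := by
    have ha : Primrec fun p : (List (α × Bool) × S) × S => p.1.2.1 :=
      Primrec.fst.comp (Primrec.snd.comp Primrec.fst)
    have hb : Primrec fun p : (List (α × Bool) × S) × S => p.2.1 :=
      Primrec.fst.comp Primrec.snd
    have hl : Primrec fun p : (List (α × Bool) × S) × S => p.2.2 :=
      Primrec.snd.comp Primrec.snd
    refine Primrec.ite (PrimrecPred.and ?_ ?_) hl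
      (Primrec.list_cons.comp ha (Primrec.list_cons.comp hb hl))
    · exact Primrec.eq.comp (Primrec.fst.comp ha) (Primrec.fst.comp hb)
    · exact Primrec.eq.comp (Primrec.snd.comp ha) (Primrec.not.comp (Primrec.snd.comp hb))
  have hstep : Primrec₂ fun (_ : List (α × Bool)) (p : S) =>
      (List.casesOn p.2 [p.1] fun b l =>
        if p.1.1 = b.1 ∧ p.1.2 = !b.2 then l else p.1 :: b :: l : List (α × Bool)) :=
    Primrec.list_casesOn (Primrec.snd.comp Primrec.snd)
      (Primrec.list_cons.comp (Primrec.fst.comp Primrec.snd) (Primrec.const [])) hcons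
  exact (Primrec.list_foldr Primrec.id (Primrec.const []) hstep).of_eq
    fun L => (reduce_eq_foldr L).symm

theorem mk_flatMap_toWord {β : Type*} (f : FreeGroup β →* FreeGroup α) (L : List (β × Bool)) :
    mk (L.flatMap fun a => (f (mk [a])).toWord) = f (mk L) := by
  induction L with
  | nil => simp [← one_eq_mk]
  | cons a l ih =>
    rw [List.flatMap_cons, ← mul_mk, mk_toWord, ih, ← map_mul, mul_mk, List.singleton_append]

variable {C ι : Type*} [Group C] {θ : C →* MulAut (FreeGroup α)}

theorem toWord_left_val_cons (s : ι → FreeGroup α ⋊[θ] C) (c : ι × Bool) (w : GroupWord ι) :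
    (GroupWord.val s (c :: w)).left.toWord =
      reduce ((GroupWord.val s [c]).left.toWord ++ (w.val s).left.toWord.flatMap fun a =>
        (θ (GroupWord.val s [c]).right (mk [a])).toWord) := by
  have himage := mk_flatMap_toWord (θ (GroupWord.val s [c]).right).toMonoidHom
    (GroupWord.val s w).left.toWord
  rw [mk_toWord] at himage
  rw [← toWord_mk, ← mul_mk, mk_toWord, GroupWord.val_cons, mul_left]
  exact congrArg (fun x => ((GroupWord.val s [c]).left * x).toWord) himage.symm

theorem primrec_toWord_left_val [Finite α] [Primcodable α] [Finite ι] [Primcodable ι]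
    (s : ι → FreeGroup α ⋊[θ] C) :
    Primrec fun w : GroupWord ι => (w.val s).left.toWord := by
  have hstep : Primrec₂ fun (_ : GroupWord ι) (p : (ι × Bool) × List (α × Bool)) =>
      reduce ((GroupWord.val s [p.1]).left.toWord ++ p.2.flatMap fun a =>
        (θ (GroupWord.val s [p.1]).right (mk [a])).toWord) := by
    have hletter : Primrec fun c : ι × Bool => (GroupWord.val s [c]).left.toWord :=
      Primrec.dom_finite _
    have himage : Primrec₂ fun (c : ι × Bool) (a : α × Bool) =>
        (θ (GroupWord.val s [c]).right (mk [a])).toWord := Primrec.dom_finite _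
    have himages : Primrec fun p : (ι × Bool) × List (α × Bool) =>
        p.2.flatMap fun a => (θ (GroupWord.val s [p.1]).right (mk [a])).toWord :=
      Primrec.list_flatMap Primrec.snd
        (himage.comp₂ (Primrec.fst.comp Primrec.fst) Primrec.snd)
    exact primrec_reduce.comp
      (Primrec.list_append.comp (hletter.comp (Primrec.fst.comp Primrec.snd))
        (himages.comp Primrec.snd))
  refine (Primrec.list_foldr Primrec.id (Primrec.const []) hstep).of_eq fun w => ?_
  rw [id_eq]
  induction w with
  | nil => simp [GroupWord.val]
  | cons c w ih => rw [toWord_left_val_cons, ← ih, List.foldr_cons]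

end Primrec

section Cyclic

variable {C ι : Type*} [Group C] {t : C} [Finite ι] [Primcodable ι]

theorem primrec_sum_map (p : ι × Bool → ℕ) : Primrec fun w : GroupWord ι => (w.map p).sum := by
  have hstep : Primrec₂ fun (_ : GroupWord ι) (q : (ι × Bool) × ℕ) => p q.1 + q.2 :=
    Primrec.nat_add.comp ((Primrec.dom_finite p).comp (Primrec.fst.comp Primrec.snd))
      (Primrec.snd.comp Primrec.snd)
  exact (Primrec.list_foldr Primrec.id (Primrec.const 0) hstep).of_eq fun w =>
    List.foldr_map.symm

theorem exists_primrec_val_eq_zpow (ht : ∀ c, c ∈ Subgroup.zpowers t) (s : ι → C) :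
    ∃ P N : GroupWord ι → ℕ, Primrec P ∧ Primrec N ∧ ∀ w, w.val s = t ^ ((P w : ℤ) - N w) := by
  choose e he using fun c : ι × Bool => ht (GroupWord.val s [c])
  refine ⟨_, _, primrec_sum_map fun c => (e c).toNat, primrec_sum_map fun c => (-e c).toNat,
    fun w => ?_⟩
  induction w with
  | nil => simp [GroupWord.val]
  | cons c w ih =>
    rw [GroupWord.val_cons, ih, ← he c, ← zpow_add, List.map_cons, List.map_cons, List.sum_cons,
      List.sum_cons]
    congr 1
    have := (e c).toNat_sub_toNat_neg
    push_cast
    lia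

theorem primrecRel_val_eq_val_of_cyclic (ht : ∀ c, c ∈ Subgroup.zpowers t) (s : ι → C) :
    PrimrecRel fun u v : GroupWord ι => u.val s = v.val s := by
  obtain ⟨P, N, hP, hN, hPN⟩ := exists_primrec_val_eq_zpow ht s
  have hmod : PrimrecRel fun u v => P u + N v ≡ P v + N u [MOD orderOf t] :=
    Primrec.eq.comp
      (Primrec.nat_mod.comp (Primrec.nat_add.comp (hP.comp Primrec.fst) (hN.comp Primrec.snd))
        (Primrec.const _))
      (Primrec.nat_mod.comp (Primrec.nat_add.comp (hP.comp Primrec.snd) (hN.comp Primrec.fst))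
        (Primrec.const _))
  refine hmod.of_eq fun u v => ?_
  have hshift (a b c : ℕ) : t ^ (a + c) = t ^ ((a : ℤ) - b) * t ^ ((b : ℤ) + c) := by
    rw [← zpow_add, ← add_assoc, sub_add_cancel, ← zpow_natCast, Nat.cast_add]
  rw [← pow_eq_pow_iff_modEq, hPN, hPN, hshift (P u) (N u), hshift (P v) (N v),
    add_comm (N v : ℤ), mul_left_inj]

end Cyclic

/-- All lists of length at most `n` over a finite alphabet, enumerated recursively so that the
enumeration is primitive recursive. It is the search space for conjugators. -/
noncomputable def listsOfLengthLE (β : Type*) [Fintype β] (n : ℕ) : List (List β) :=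
  Nat.rec [[]] (fun _ L => [] :: L.flatMap fun v => Finset.univ.toList.map fun a => a :: v) n

theorem mem_listsOfLengthLE {β : Type*} [Fintype β] {n : ℕ} {v : List β} :
    v ∈ listsOfLengthLE β n ↔ v.length ≤ n := by
  induction n generalizing v with
  | zero => simp [listsOfLengthLE]
  | succ n ih =>
    change v ∈ [] :: (listsOfLengthLE β n).flatMap _ ↔ _
    cases v with
    | nil => simp
    | cons a v => simp [ih]

theorem primrec_listsOfLengthLE {β : Type*} [Fintype β] [Primcodable β] :
    Primrec (listsOfLengthLE β) := by
  have hstep : Primrec fun L : List (List β) =>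
      [] :: L.flatMap fun v => (Finset.univ : Finset β).toList.map fun a => a :: v := by
    refine Primrec.list_cons.comp (Primrec.const []) (Primrec.list_flatMap Primrec.id ?_)
    exact Primrec.list_map (Primrec.const _)
      (Primrec.list_cons.comp Primrec.snd (Primrec.snd.comp Primrec.fst))
  exact Primrec.nat_rec₁ _ (hstep.comp Primrec.snd)

theorem conjugacyProblemSolvable_of_length_le {G ι : Type*} [Group G] [Finite ι] [Primcodable ι]
    {s : ι → G} (hword : PrimrecRel fun u v : GroupWord ι => u.val s = v.val s)
    {B : GroupWord ι → GroupWord ι → ℕ} (hB : Primrec₂ B)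
    (hconj : ∀ u v : GroupWord ι, IsConj (u.val s) (v.val s) →
      ∃ w : GroupWord ι, SemiconjBy (w.val s) (u.val s) (v.val s) ∧ w.length ≤ B u v) :
    ConjugacyProblemSolvable s := by
  have := Fintype.ofFinite ι
  have hsemiconj : PrimrecRel fun (w : GroupWord ι) (p : GroupWord ι × GroupWord ι) =>
      GroupWord.val s (w ++ p.1) = GroupWord.val s (p.2 ++ w) :=
    hword.comp
      (Primrec.list_append.comp Primrec.fst (Primrec.fst.comp Primrec.snd))
      (Primrec.list_append.comp (Primrec.snd.comp Primrec.snd) Primrec.fst)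
  have hsearch := hsemiconj.exists_mem_list.comp
    ((primrec_listsOfLengthLE (β := ι × Bool)).comp hB) Primrec.id
  refine hsearch.computablePred.of_eq fun p => ?_
  simp only [mem_listsOfLengthLE, GroupWord.val_append, id_eq]
  constructor
  · rintro ⟨w, -, hw⟩
    exact isConj_iff.2 ⟨w.val s, mul_inv_eq_of_eq_mul hw⟩
  · intro h
    obtain ⟨w, hw, hle⟩ := hconj p.1 p.2 h
    exact ⟨w, hle, hw⟩

section NormalForm

variable {β : Type*} [Primcodable β] {R : β → β → Prop}

theorem computablePred_exists_decode_eq (h : ComputablePred fun p : β × β => R p.1 p.2) :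
    ComputablePred fun p : β × ℕ => ∃ y, Encodable.decode (α := β) p.2 = some y ∧ R p.1 y := by
  obtain ⟨r, hr, hrR⟩ := ComputablePred.computable_iff.1 h
  have hrR (x y : β) : R x y ↔ r (x, y) = true := iff_of_eq (congrFun hrR (x, y))
  have hsome : Computable₂ fun (p : β × ℕ) (y : β) => r (p.1, y) :=
    hr.comp ((Computable.fst.comp Computable.fst).pair Computable.snd)
  have hdecode : Computable fun p : β × ℕ => Encodable.decode (α := β) p.2 :=
    Computable.decode.comp Computable.snd
  refine ComputablePred.computable_iff.2
    ⟨_, Computable.option_casesOn hdecode (Computable.const false) hsome, funext fun p => ?_⟩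
  cases Encodable.decode (α := β) p.2 <;> simp [hrR]

/-- The normal form of `x` is the element with the smallest code among those related to `x`. -/
theorem exists_computable_normalForm (hR : Equivalence R)
    (h : ComputablePred fun p : β × β => R p.1 p.2) :
    ∃ nf : β → β, Computable nf ∧ (∀ x, R x (nf x)) ∧ ∀ x y, R x y ↔ nf x = nf y := by
  classical
  let P : β → ℕ → Prop := fun x k => ∃ y, Encodable.decode (α := β) k = some y ∧ R x y
  have hex (x : β) : ∃ k, P x k := ⟨Encodable.encode x, x, Encodable.encodek x, hR.refl x⟩
  have hP_congr {x y : β} (hxy : R x y) : P x = P y := by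
    ext k
    exact exists_congr fun z => and_congr_right fun _ =>
      ⟨hR.trans (hR.symm hxy), hR.trans hxy⟩
  choose nf hnf using fun x => Nat.find_spec (hex x)
  refine ⟨nf, ?_, fun x => (hnf x).2, fun x y => ⟨fun hxy => ?_, fun hxy => ?_⟩⟩
  · have hfind : Computable fun x => Encodable.decode (α := β) (Nat.find (hex x)) :=
      Computable.decode.comp (Computable.find (computablePred_exists_decode_eq h) hex)
    exact (Computable.option_getD hfind Computable.id).of_eq fun x => by
      rw [(hnf x).1, Option.getD_some]
  · have hcode := (hnf x).1
    simp only [hP_congr hxy, (hnf y).1, Option.some.injEq] at hcode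
    exact hcode.symm
  · exact hR.trans (hnf x).2 (hxy ▸ hR.symm (hnf y).2)

end NormalForm

theorem exists_isComputableConjugacyNormalForm {G ι : Type*} [Group G] [Primcodable ι] {s : ι → G}
    (h : ConjugacyProblemSolvable s) : ∃ nf, IsComputableConjugacyNormalForm s nf :=
  exists_computable_normalForm (R := fun u v : GroupWord ι => IsConj (u.val s) (v.val s))
    ⟨fun _ => IsConj.refl _, IsConj.symm, IsConj.trans⟩ h

section WordProblem

variable {α C ι : Type*} [Finite α] [Group C] {θ : C →* MulAut (FreeGroup α)} {t : C}
  [Finite ι] [Primcodable ι]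

theorem primrecRel_val_eq_val [Primcodable α] (ht : ∀ c, c ∈ Subgroup.zpowers t)
    (s : ι → FreeGroup α ⋊[θ] C) :
    PrimrecRel fun u v : GroupWord ι => u.val s = v.val s := by
  classical
  have hleft := primrec_toWord_left_val s
  have hright := primrecRel_val_eq_val_of_cyclic ht (rightHom ∘ s)
  refine (PrimrecPred.and (Primrec.eq.comp (hleft.comp Primrec.fst) (hleft.comp Primrec.snd))
    hright).of_eq fun p => ?_
  simp only [toWord_inj, SemidirectProduct.ext_iff, ← GroupWord.map_val]
  rfl

theorem conjugacyProblemSolvable_of_isVirtuallyInner [Primcodable α]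
    (ht : ∀ c, c ∈ Subgroup.zpowers t) (hθ : IsVirtuallyInner (θ t))
    {s : ι → FreeGroup α ⋊[θ] C} (hs : Subgroup.closure (Set.range s) = ⊤) :
    ConjugacyProblemSolvable s := by
  classical
  obtain ⟨A, hA⟩ := exists_groupWord_semiconjBy_length_le ht hθ hs
  obtain ⟨P, N, hP, hN, hPN⟩ := exists_primrec_val_eq_zpow ht (rightHom ∘ s)
  have hleft : Primrec fun w : GroupWord ι => (w.val s).left.norm :=
    Primrec.list_length.comp (primrec_toWord_left_val s)
  have hB : Primrec₂ fun u v : GroupWord ι =>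
      A * ((u.val s).left.norm + (v.val s).left.norm + (P u + N u) + 1) := by
    refine Primrec.nat_mul.comp (Primrec.const A) (Primrec.succ.comp ?_)
    exact Primrec.nat_add.comp
      (Primrec.nat_add.comp (hleft.comp Primrec.fst) (hleft.comp Primrec.snd))
      (Primrec.nat_add.comp (hP.comp Primrec.fst) (hN.comp Primrec.fst))
  refine conjugacyProblemSolvable_of_length_le (primrecRel_val_eq_val ht s) hB fun u v huv => ?_
  have hu : (u.val s).right = t ^ ((P u : ℤ) - N u) :=
    (GroupWord.map_val rightHom s u).trans (hPN u)
  obtain ⟨w, hw, hle⟩ := hA _ _ _ hu huv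
  exact ⟨w, hw, hle.trans (Nat.mul_le_mul_left A (by lia))⟩

end WordProblem

theorem closure_range_splitExtensionGen {n : ℕ} {C : Type*} [Group C]
    {θ : C →* MulAut (FreeGroup (Fin n))} {t : C} (ht : ∀ c, c ∈ Subgroup.zpowers t) :
    Subgroup.closure (Set.range (splitExtensionGen θ t)) = ⊤ := by
  let H := Subgroup.closure (Set.range (splitExtensionGen θ t))
  have hgen (i : Option (Fin n)) : splitExtensionGen θ t i ∈ H :=
    Subgroup.subset_closure ⟨i, rfl⟩
  have hinl : (⊤ : Subgroup (FreeGroup (Fin n))) ≤ H.comap inl := by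
    rw [← closure_range_of, Subgroup.closure_le]
    rintro _ ⟨i, rfl⟩
    exact hgen (some i)
  refine (Subgroup.eq_top_iff' _).2 fun x => ?_
  obtain ⟨k, hk⟩ := ht x.right
  rw [← inl_left_mul_inr_right x, ← hk, map_zpow]
  exact mul_mem (hinl (Subgroup.mem_top x.left)) (zpow_mem (hgen none) k)

end FreeByCyclic

theorem theorem3p1_general {α : Type*} [Finite α] {C : Type*} [Group C] {t : C}
    (ht : ∀ c, c ∈ Subgroup.zpowers t) {θ : C →* MulAut (FreeGroup α)}
    (hθ : IsVirtuallyInner (θ t)) {ι : Type*} [Finite ι] [Primcodable ι]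
    {s : ι → FreeGroup α ⋊[θ] C} (hs : Subgroup.closure (Set.range s) = ⊤) :
    ConjugacyProblemSolvable s ∧ ∃ nf, IsComputableConjugacyNormalForm s nf := by
  classical
  let : Primcodable α := Primcodable.ofEquiv _ (Finite.equivFin α)
  have h := FreeByCyclic.conjugacyProblemSolvable_of_isVirtuallyInner ht hθ hs
  exact ⟨h, FreeByCyclic.exists_isComputableConjugacyNormalForm h⟩

/-- `C = ⟨t⟩` is a cyclic group of any finite or infinite order, and conjugation by `t` in
`Fₙ ⋊ ⟨t⟩` induces `φ`, that is `t⁻¹ f t = φ f`. -/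
theorem theorem3p1 (n : ℕ) (hn : 2 ≤ n)
    (φ : MulAut (FreeGroup (Fin n))) (hφ : IsVirtuallyInner φ)
    {C : Type*} [Group C] (t : C) (ht : ∀ c : C, c ∈ Subgroup.zpowers t)
    (θ : C →* MulAut (FreeGroup (Fin n)))
    (hθ : ∀ f : FreeGroup (Fin n),
      (SemidirectProduct.inr t : FreeGroup (Fin n) ⋊[θ] C)⁻¹ * SemidirectProduct.inl f *
        SemidirectProduct.inr t = SemidirectProduct.inl (φ f)) :
    ConjugacyProblemSolvable (splitExtensionGen θ t) ∧
      ∃ nf : GroupWord (Option (Fin n)) → GroupWord (Option (Fin n)),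
        IsComputableConjugacyNormalForm (splitExtensionGen θ t) nf := by
  have hφθ : φ = θ t⁻¹ := by
    ext1 f
    apply SemidirectProduct.inl_injective (φ := θ)
    rw [← hθ, SemidirectProduct.inl_aut, inv_inv, map_inv]
  exact theorem3p1_general (t := t⁻¹) (by simpa using ht) (hφθ ▸ hφ)
    (FreeByCyclic.closure_range_splitExtensionGen ht)
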